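/- Let $k\ge 1$ and let $0=r_0<r_1\le r_2\le\dots\le r_k\le r_{k+1}=n$ be integers. For $q=(q_1,\dots,q_k)\in\mathbb{C}^k$ consider, in the $r_1+\dots+r_k$ complex unknowns $z_{s,j}$ ($1\le j\le k$, $1\le s\le r_j$), the system of polynomial equations $$\prod_{a=1}^{r_{j+1}}(z_{s,j}-z_{a,j+1})-q_j\prod_{b=1}^{r_{j-1}}(z_{s,j}-z_{b,j-1})=0\qquad(1\le j\le k,\ 1\le s\le r_j),$$ where $z_{a,k+1}:=0$ for all $1\le a\le n$ and where, for $j=1$, the second product is empty and equals $1$. Let $X(q)$ be the closed subscheme of affine space $\mathbb{A}^{r_1+\dots+r_k}$ over $\mathbb{C}$ cut out by these equations, and let $N(q)$ be the number of its closed points, counted without multiplicity; equivalently, $N(q)$ is the number of distinct complex solutions of the system. Then there is a nonempty Zariski open subset $U\subseteq(\mathbb{C}^*)^k$ such that for every $q\in U$ the system has exactly the Bézout number of distinct solutions, $$N(q)=\prod_{j=1}^k r_{j+1}^{\,r_j},$$ and the number of those solutions that are non-degenerate, i.e. satisfy $z_{s,j}\ne z_{u,j}$ for all $1\le j\le k$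 and all $s\ne u$, is exactly $$\prod_{j=1}^k\frac{r_{j+1}!}{(r_{j+1}-r_j)!}.$$ -/

import Mathlib

open scoped Nat

namespace FlagBethe

/-- Index set of the variables `z_{s,j}`, `1 ≤ j ≤ k`, `1 ≤ s ≤ r_j`. The element `⟨j, s⟩` (both
entries counted from `0`) stands for the variable `z_{s+1, j+1}`. -/
abbrev Idx (k : ℕ) (r : ℕ → ℕ) : Type := Σ j : Fin k, Fin (r (j + 1))

/-- The polynomial `z_{a,j}` for every level `j`: a variable for `1 ≤ j ≤ k`, and `0` for `j = k + 1`.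
(Level `0` has no entries since `r 0 = 0`; levels above `k + 1` are never used.) -/
noncomputable def levelVar (k : ℕ) (r : ℕ → ℕ) : (j : ℕ) → Fin (r j) → MvPolynomial (Idx k r) ℂ
  | 0, _ => 0
  | j + 1, a => if h : j < k then MvPolynomial.X ⟨⟨j, h⟩, a⟩ else 0

/-- The polynomial `∏_a (z_{s,j} - z_{a,j+1}) - q_j ∏_b (z_{s,j} - z_{b,j-1})`, where the level called
`j` in the formula is `i.1 + 1`. -/
noncomputable def eqn (k : ℕ) (r : ℕ → ℕ) (q : Fin k → ℂ) (i : Idx k r) :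
    MvPolynomial (Idx k r) ℂ :=
  ∏ a : Fin (r (i.1 + 2)), (MvPolynomial.X i - levelVar k r (i.1 + 2) a)
    - MvPolynomial.C (q i.1) * ∏ b : Fin (r i.1), (MvPolynomial.X i - levelVar k r i.1 b)

/-- The closed subscheme `X(q)` of affine space cut out by the system. -/
noncomputable def scheme (k : ℕ) (r : ℕ → ℕ) (q : Fin k → ℂ) : AlgebraicGeometry.Scheme :=
  AlgebraicGeometry.Spec
    (CommRingCat.of (MvPolynomial (Idx k r) ℂ ⧸ Ideal.span (Set.range (eqn k r q))))

/-- The number `N(q)` of closed points of `X(q)`, counted without multiplicity. -/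
noncomputable def N (k : ℕ) (r : ℕ → ℕ) (q : Fin k → ℂ) : ℕ∞ :=
  (closedPoints (scheme k r q)).encard

/-- The set of complex solutions of the system. -/
def solutions (k : ℕ) (r : ℕ → ℕ) (q : Fin k → ℂ) : Set (Idx k r → ℂ) :=
  {z | ∀ i, MvPolynomial.eval z (eqn k r q i) = 0}

/-- Non-degenerate: `z_{s,j} ≠ z_{u,j}` for all `j` and all `s ≠ u`. -/
def NonDegenerate {k : ℕ} {r : ℕ → ℕ} (z : Idx k r → ℂ) : Prop :=
  ∀ (j : Fin k) (s u : Fin (r (j + 1))), s ≠ u → z ⟨j, s⟩ ≠ z ⟨j, u⟩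

/-- `p` holds for generic `q` in the torus `(ℂ^*)^k`, i.e. on a nonempty Zariski open subset: it holds
wherever some nonzero polynomial does not vanish. -/
def ForGeneric (k : ℕ) (p : (Fin k → ℂ) → Prop) : Prop :=
  ∃ F : MvPolynomial (Fin k) ℂ, F ≠ 0 ∧
    ∀ q : Fin k → ℂ, (∀ j, q j ≠ 0) → MvPolynomial.eval q F ≠ 0 → p q

end FlagBethe

/-! The solutions are counted by squeezing.

Upper bound: at `q = 0` the equations can be solved for the pure powers `z_{s,j} ^ r_{j+1}` modulo
terms involving variables of a higher level, so the monomials of degree less than `r_{j+1}` in each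
`z_{s,j}` span the quotient ring. By Nakayama's lemma they still span it for generic `q`, whence
there are at most `D = ∏ j, r_{j+1} ^ r_j` solutions.

Lower bound: substituting `z_{s,j} = t ^ j y_{s,j}` along a monomial curve `q(t)`, the system
degenerates at `t = 0` to `y_{s,j} ^ r_{j+1} = c_j ∏ b, (-y_{b,j-1})`, a tower of root extractions
with `D` simple solutions. By the implicit function theorem these deform to `t ≠ 0`, and since the
system is symmetric on each level the deformation preserves coincidences of coordinates. So if `m`
of the `D` choices of roots are distinct on each level, then for a Zariski dense set of `q` there
are at least `m` non-degenerate and at least `D - m` degenerate solutions. By Chevalley's theorem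
both bounds then hold for generic `q`, and together with the upper bound they are equalities.
-/

namespace FlagBethe

open MvPolynomial Filter Topology

section Generic

/-- The filter of sets of parameters in affine space that contain a nonempty principal open subset,
so that `∀ᶠ q in generic K κ, p q` says that `p` holds for generic `q`. Over an infinite field,
`∃ᶠ q in generic K κ, p q` says that `p` holds on a Zariski dense set. -/
def generic (K κ : Type*) [CommRing K] [IsDomain K] : Filter (κ → K) where
  sets := {s | ∃ F : MvPolynomial κ K, F ≠ 0 ∧ ∀ q, eval q F ≠ 0 → q ∈ s}
  univ_sets := ⟨1, one_ne_zero, fun _ _ => Set.mem_univ _⟩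
  sets_of_superset := fun ⟨F, hF, h⟩ hst => ⟨F, hF, fun q hq => hst (h q hq)⟩
  inter_sets := by
    rintro s t ⟨F, hF, hs⟩ ⟨G, hG, ht⟩
    refine ⟨F * G, mul_ne_zero hF hG, fun q hq => ?_⟩
    rw [map_mul] at hq
    exact ⟨hs q (left_ne_zero_of_mul hq), ht q (right_ne_zero_of_mul hq)⟩

variable {K κ : Type*} [CommRing K] [IsDomain K] {p : (κ → K) → Prop}

theorem eventually_generic_iff : (∀ᶠ q in generic K κ, p q) ↔
    ∃ F : MvPolynomial κ K, F ≠ 0 ∧ ∀ q, eval q F ≠ 0 → p q :=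
  Iff.rfl

theorem frequently_generic_iff : (∃ᶠ q in generic K κ, p q) ↔
    ∀ F : MvPolynomial κ K, F ≠ 0 → ∃ q, eval q F ≠ 0 ∧ p q := by
  simp only [Filter.Frequently, eventually_generic_iff]
  push Not
  rfl

theorem frequently_generic_of_frequently_cofinite {K κ : Type*} [Field K] [Infinite K] [Finite κ]
    {p : (κ → K) → Prop} (e : κ → ℕ)
    (h : ∀ c : κ → K, (∀ j, c j ≠ 0) → ∃ᶠ t in cofinite, p fun j => c j * t ^ e j) :
    ∃ᶠ q in generic K κ, p q := by
  have := Fintype.ofFinite κ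
  rw [frequently_generic_iff]
  intro F hF
  have hF' : F * ∏ j, X j ≠ 0 := mul_ne_zero hF (Finset.prod_ne_zero_iff.2 fun j _ => X_ne_zero j)
  obtain ⟨c, hc⟩ : ∃ c, eval c (F * ∏ j, X j) ≠ 0 := by
    simpa using mt MvPolynomial.funext_iff.2 hF'
  simp only [map_mul, map_prod, eval_X, mul_ne_zero_iff, Finset.prod_ne_zero_iff, Finset.mem_univ,
    true_imp_iff] at hc
  let f : Polynomial K := aeval (fun j => Polynomial.C (c j) * Polynomial.X ^ e j) F
  have hf (t) : f.eval t = eval (fun j => c j * t ^ e j) F := by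
    rw [← Polynomial.coe_aeval_eq_eval, comp_aeval_apply, aeval_eq_eval]
    simp
  have hf0 : f ≠ 0 := fun h0 => hc.1 (by simpa [h0] using (hf 1).symm)
  have hroots : ∀ᶠ t in cofinite, f.eval t ≠ 0 :=
    (Polynomial.finite_setOfPred_isRoot hf0).eventually_cofinite_notMem
  obtain ⟨t, ht, hft⟩ := ((h c hc.2).and_eventually hroots).exists
  exact ⟨_, hf t ▸ hft, ht⟩

end Generic

section Points

theorem algHom_eq_of_ker_le {R A : Type*} [CommRing R] [CommRing A] [Algebra R A]
    {χ ψ : A →ₐ[R] R} (h : RingHom.ker χ ≤ RingHom.ker ψ) : χ = ψ := by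
  ext a
  have ha : a - algebraMap R A (χ a) ∈ RingHom.ker χ := by simp [RingHom.mem_ker]
  have := h ha
  rw [RingHom.mem_ker, map_sub, AlgHom.commutes] at this
  exact (sub_eq_zero.1 this).symm

variable {K A : Type*} [Field K] [IsAlgClosed K] [CommRing A] [Algebra K A]
  [Algebra.FiniteType K A]

theorem exists_algHom_ker_eq (m : Ideal A) [hm : m.IsMaximal] :
    ∃ χ : A →ₐ[K] K, RingHom.ker χ = m := by
  let _ := Ideal.Quotient.field m
  have : Module.Finite K (A ⧸ m) := finite_of_finite_type_of_isJacobsonRing K (A ⧸ m)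
  let e : K ≃ₐ[K] A ⧸ m :=
    AlgEquiv.ofBijective (Algebra.ofId K (A ⧸ m)) IsAlgClosed.algebraMap_bijective_of_isIntegral
  refine ⟨e.symm.toAlgHom.comp (Ideal.Quotient.mkₐ K m), ?_⟩
  ext a
  simp [RingHom.mem_ker, Ideal.Quotient.eq_zero_iff_mem]

variable (K A) in
theorem encard_closedPoints_primeSpectrum :
    (closedPoints (PrimeSpectrum A)).encard = ENat.card (A →ₐ[K] K) := by
  have hmax (χ : A →ₐ[K] K) : (RingHom.ker χ).IsMaximal :=
    RingHom.ker_isMaximal_of_surjective _ fun a => ⟨algebraMap K A a, χ.commutes a⟩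
  let e (χ : A →ₐ[K] K) : closedPoints (PrimeSpectrum A) :=
    ⟨⟨_, (hmax χ).isPrime⟩, (PrimeSpectrum.isClosed_singleton_iff_isMaximal _).2 (hmax χ)⟩
  refine (ENat.card_congr (Equiv.ofBijective e ⟨fun χ ψ h => ?_, fun ⟨p, hp⟩ => ?_⟩)).symm
  · exact algHom_eq_of_ker_le (congrArg (fun x => x.1.asIdeal) h).le
  · have := (PrimeSpectrum.isClosed_singleton_iff_isMaximal _).1 hp
    obtain ⟨χ, hχ⟩ := exists_algHom_ker_eq (K := K) p.asIdeal
    exact ⟨χ, Subtype.ext (PrimeSpectrum.ext hχ)⟩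

end Points

theorem encard_zeros_eq_card_algHom {R σ ι : Type*} [CommRing R] (f : ι → MvPolynomial σ R) :
    {z : σ → R | ∀ i, eval z (f i) = 0}.encard =
      ENat.card (MvPolynomial σ R ⧸ Ideal.span (Set.range f) →ₐ[R] R) := by
  have hz (z : {z : σ → R | ∀ i, eval z (f i) = 0}) (p : MvPolynomial σ R)
      (hp : p ∈ Ideal.span (Set.range f)) : aeval z.1 p = 0 := by
    have : Ideal.span (Set.range f) ≤ RingHom.ker (aeval (R := R) z.1) :=
      Ideal.span_le.2 (Set.range_subset_iff.2 z.2)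
    exact this hp
  refine ENat.card_congr
    { toFun := fun z => Ideal.Quotient.liftₐ _ (aeval z.1) (hz z)
      invFun := fun χ => ⟨fun i => χ (Ideal.Quotient.mk _ (X i)), fun i => ?_⟩
      left_inv := fun z => Subtype.ext (funext fun i => by simp)
      right_inv := fun χ => Ideal.Quotient.algHom_ext _ (by ext; simp) }
  have hχ : χ.comp (Ideal.Quotient.mkₐ R _) = aeval fun i => χ (Ideal.Quotient.mk _ (X i)) := by
    ext; simp
  rw [← coe_aeval_eq_eval, RingHom.coe_coe, ← hχ, AlgHom.comp_apply, Ideal.Quotient.mkₐ_eq_mk,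
    Ideal.Quotient.eq_zero_iff_mem.2 (Ideal.subset_span (Set.mem_range_self i)), map_zero]

theorem N_eq_encard_solutions (k : ℕ) (r : ℕ → ℕ) (q : Fin k → ℂ) :
    N k r q = (solutions k r q).encard :=
  (encard_closedPoints_primeSpectrum ℂ _).trans (encard_zeros_eq_card_algHom (eqn k r q)).symm

section Chevalley

theorem exists_forall_mem_range_comap {A B : Type*} [CommRing A] [IsDomain A] [CommRing B]
    {f : A →+* B} (hfp : f.FinitePresentation) (hf : Function.Injective f) :
    ∃ a : A, a ≠ 0 ∧ ∀ x : PrimeSpectrum A, a ∉ x.asIdeal →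
      x ∈ Set.range (PrimeSpectrum.comap f) := by
  obtain ⟨S, hS⟩ :=
    PrimeSpectrum.exists_constructibleSetData_iff.2 (PrimeSpectrum.isConstructible_range_comap hfp)
  have hbot : (⊥ : PrimeSpectrum A) ∈ Set.range (PrimeSpectrum.comap f) := by
    obtain ⟨p, hp, hpf⟩ := Ideal.exists_comap_eq_of_mem_minimalPrimes_of_injective hf
      (⊥ : Ideal A) (by simp [IsDomain.minimalPrimes_eq_singleton_bot])
    exact ⟨⟨p, hp⟩, PrimeSpectrum.ext hpf⟩
  rw [← hS, PrimeSpectrum.ConstructibleSetData.toSet] at hbot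
  obtain ⟨c, hcS, hcg, hcf⟩ := Set.mem_iUnion₂.1 hbot
  refine ⟨c.f, fun h0 => hcf (by simp [h0]), fun x hx => ?_⟩
  rw [← hS]
  refine Set.mem_iUnion₂.2 ⟨c, hcS, ?_, by simpa using hx⟩
  rintro _ ⟨i, rfl⟩
  have hgi : c.g i = 0 := hcg (Set.mem_range_self i)
  rw [hgi]
  exact Ideal.zero_mem _

variable {K : Type*} [Field K] [IsAlgClosed K]

theorem exists_forall_algHom_extends {A B : Type*} [CommRing A] [IsDomain A] [Algebra K A]
    [Algebra.FiniteType K A] [CommRing B] [Algebra K B] [Algebra.FiniteType K B]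
    (f : A →ₐ[K] B) (hf : Function.Injective f) :
    ∃ a : A, a ≠ 0 ∧ ∀ ψ : A →ₐ[K] K, ψ a ≠ 0 → ∃ χ : B →ₐ[K] K, χ.comp f = ψ := by
  have := Algebra.FiniteType.isNoetherianRing K A
  have hft : f.toRingHom.FiniteType :=
    RingHom.FiniteType.of_comp_finiteType (f := algebraMap K A) (by
      simpa [RingHom.finiteType_algebraMap] using ‹Algebra.FiniteType K B›)
  obtain ⟨a, ha, hrange⟩ :=
    exists_forall_mem_range_comap (RingHom.FinitePresentation.of_finiteType.1 hft) hf
  refine ⟨a, ha, fun ψ hψ => ?_⟩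
  obtain ⟨p, hp⟩ := hrange ⟨RingHom.ker ψ, RingHom.ker_isPrime _⟩ hψ
  obtain ⟨m, hm, hpm⟩ := Ideal.exists_le_maximal p.asIdeal p.2.ne_top
  obtain ⟨χ, hχ⟩ := exists_algHom_ker_eq (K := K) m
  refine ⟨χ, (algHom_eq_of_ker_le fun x hx => ?_).symm⟩
  have hxp : x ∈ p.asIdeal.comap f.toRingHom := by
    rwa [show p.asIdeal.comap f.toRingHom = RingHom.ker ψ from congrArg PrimeSpectrum.asIdeal hp]
  exact hχ.ge (hpm hxp)

theorem eventually_exists_algHom_of_frequently {κ B : Type*} [Finite κ] [CommRing B] [Algebra K B]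
    [Algebra.FiniteType K B] (f : MvPolynomial κ K →ₐ[K] B)
    (h : ∃ᶠ q in generic K κ, ∃ χ : B →ₐ[K] K, χ.comp f = aeval q) :
    ∀ᶠ q in generic K κ, ∃ χ : B →ₐ[K] K, χ.comp f = aeval q := by
  have hf : Function.Injective f := by
    refine (injective_iff_map_eq_zero f).2 fun F hF => by_contra fun hne => ?_
    obtain ⟨q, hq, χ, hχ⟩ := frequently_generic_iff.1 h F hne
    have := AlgHom.congr_fun hχ F
    rw [AlgHom.comp_apply, hF, map_zero, aeval_eq_eval] at this
    exact hq this.symm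
  obtain ⟨F, hF, hext⟩ := exists_forall_algHom_extends f hf
  exact eventually_generic_iff.2 ⟨F, hF, fun q hq => hext (aeval q) (by rwa [aeval_eq_eval])⟩

end Chevalley

section Fiber

variable {K κ σ : Type*}

/-- The set of solutions of a polynomial system `P` with parameters, specialized at `q`, at which
the specialization of `g` does not vanish. -/
def fiber [CommRing K] (P : Set (MvPolynomial σ (MvPolynomial κ K)))
    (g : MvPolynomial σ (MvPolynomial κ K)) (q : κ → K) : Set (σ → K) :=
  {z | (∀ p ∈ P, eval z (map (eval q) p) = 0) ∧ eval z (map (eval q) g) ≠ 0}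

theorem aevalTower_aeval_apply [CommRing K] (q : κ → K) (z : σ → K)
    (p : MvPolynomial σ (MvPolynomial κ K)) :
    aevalTower (aeval q) z p = eval z (map (eval q) p) := by
  rw [eval_map]
  rfl

theorem eq_aevalTower {R S T : Type*} [CommRing R] [CommRing S] [Algebra R S] [CommRing T]
    [Algebra R T] {θ : MvPolynomial σ S →ₐ[R] T} {ψ : S →ₐ[R] T} (h : ∀ s, θ (C s) = ψ s) :
    θ = aevalTower ψ fun i => θ (X i) := by
  suffices (θ : MvPolynomial σ S →+* T) = aevalTower ψ fun i => θ (X i) from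
    AlgHom.coe_ringHom_injective this
  exact ringHom_ext (fun s => (h s).trans (aevalTower_C _ _ s).symm)
    fun i => (aevalTower_X ψ (fun i => θ (X i)) i).symm

theorem exists_algHom_localizationAway_quotient_iff {R A : Type*} [CommRing R] [CommRing A]
    [Algebra R A] [Field K] [Algebra R K] (P : Set A) (g : A) (θ : A →ₐ[R] K) :
    (∃ χ : Localization.Away (Ideal.Quotient.mk (Ideal.span P) g) →ₐ[R] K,
      χ.comp (IsScalarTower.toAlgHom R A _) = θ) ↔ (∀ p ∈ P, θ p = 0) ∧ θ g ≠ 0 := by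
  constructor
  · rintro ⟨χ, rfl⟩
    refine ⟨fun p hp => ?_, ?_⟩
    · have : Ideal.Quotient.mk (Ideal.span P) p = 0 :=
        Ideal.Quotient.eq_zero_iff_mem.2 (Ideal.subset_span hp)
      simp [IsScalarTower.algebraMap_apply A (A ⧸ Ideal.span P) (Localization.Away _), this]
    · have := IsLocalization.Away.algebraMap_isUnit
        (S := Localization.Away (Ideal.Quotient.mk (Ideal.span P) g))
        (Ideal.Quotient.mk (Ideal.span P) g)
      exact (this.map χ).ne_zero
  · rintro ⟨hP, hg⟩
    have hI (p) (hp : p ∈ Ideal.span P) : θ p = 0 :=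
      (Ideal.span_le.2 hP : Ideal.span P ≤ RingHom.ker θ) hp
    have hunit : IsUnit (Ideal.Quotient.liftₐ _ θ hI (Ideal.Quotient.mk _ g)) := hg.isUnit
    refine ⟨IsLocalization.Away.liftAlgHom _ hunit, AlgHom.ext fun p => ?_⟩
    exact IsLocalization.Away.lift_eq _ hunit (Ideal.Quotient.mk _ p)

theorem fiber_nonempty_iff_exists_algHom [Field K] (P : Set (MvPolynomial σ (MvPolynomial κ K)))
    (g : MvPolynomial σ (MvPolynomial κ K)) (q : κ → K) :
    (fiber P g q).Nonempty ↔ ∃ χ : Localization.Away (Ideal.Quotient.mk (Ideal.span P) g) →ₐ[K] K,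
      χ.comp (IsScalarTower.toAlgHom K (MvPolynomial κ K) _) = aeval q := by
  have hmem (z) : z ∈ fiber P g q ↔
      (∀ p ∈ P, aevalTower (aeval (R := K) q) z p = 0) ∧ aevalTower (aeval (R := K) q) z g ≠ 0 := by
    simp only [aevalTower_aeval_apply]
    rfl
  have halg (F : MvPolynomial κ K) :
      algebraMap _ (Localization.Away (Ideal.Quotient.mk (Ideal.span P) g)) F =
        algebraMap (MvPolynomial σ (MvPolynomial κ K)) _ (C F) :=
    IsScalarTower.algebraMap_apply _ _ _ F
  simp only [Set.Nonempty, hmem, ← exists_algHom_localizationAway_quotient_iff]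
  constructor
  · rintro ⟨z, χ, hχ⟩
    refine ⟨χ, algHom_ext fun j => ?_⟩
    rw [← aevalTower_C (aeval (R := K) q) z, ← hχ, AlgHom.comp_apply, AlgHom.comp_apply,
      IsScalarTower.coe_toAlgHom', IsScalarTower.coe_toAlgHom', halg]
  · rintro ⟨χ, hχ⟩
    refine ⟨fun i => χ.comp (IsScalarTower.toAlgHom K (MvPolynomial σ (MvPolynomial κ K)) _) (X i),
      χ, eq_aevalTower fun F => ?_⟩
    rw [← hχ, AlgHom.comp_apply, AlgHom.comp_apply, IsScalarTower.coe_toAlgHom',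
      IsScalarTower.coe_toAlgHom', halg]

variable [Field K] [IsAlgClosed K] [Finite κ] [Finite σ]

theorem eventually_fiber_nonempty_of_frequently {P : Set (MvPolynomial σ (MvPolynomial κ K))}
    {g : MvPolynomial σ (MvPolynomial κ K)} (h : ∃ᶠ q in generic K κ, (fiber P g q).Nonempty) :
    ∀ᶠ q in generic K κ, (fiber P g q).Nonempty := by
  have : Algebra.FiniteType K (MvPolynomial σ (MvPolynomial κ K)) :=
    .trans (S := MvPolynomial κ K) inferInstance inferInstance
  have : Algebra.FiniteType K (Localization.Away (Ideal.Quotient.mk (Ideal.span P) g)) :=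
    inferInstance
  simp only [fiber_nonempty_iff_exists_algHom] at h ⊢
  exact eventually_exists_algHom_of_frequently _ h

theorem eventually_nonempty_embedding_fiber_of_frequently {Ω : Type*} [Finite Ω]
    {P : Set (MvPolynomial σ (MvPolynomial κ K))} {g : MvPolynomial σ (MvPolynomial κ K)}
    (h : ∃ᶠ q in generic K κ, Nonempty (Ω ↪ fiber P g q)) :
    ∀ᶠ q in generic K κ, Nonempty (Ω ↪ fiber P g q) := by
  classical
  have := Fintype.ofFinite Ω
  let P' : Set (MvPolynomial (Ω × σ) (MvPolynomial κ K)) := ⋃ α : Ω, rename (Prod.mk α) '' P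
  let g' (i : {a : Ω × Ω // a.1 ≠ a.2} → σ) : MvPolynomial (Ω × σ) (MvPolynomial κ K) :=
    (∏ α, rename (Prod.mk α) g) * ∏ a, (X (a.1.1, i a) - X (a.1.2, i a))
  have hfiber (i q) (Z : Ω × σ → K) : Z ∈ fiber P' (g' i) q ↔
      (∀ α, (fun s => Z (α, s)) ∈ fiber P g q) ∧ ∀ a, Z (a.1.1, i a) ≠ Z (a.1.2, i a) := by
    have hP' : (∀ p ∈ P', eval Z (map (eval q) p) = 0) ↔
        ∀ α, ∀ p ∈ P, eval (fun s => Z (α, s)) (map (eval q) p) = 0 := by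
      simp only [P', Set.mem_iUnion, forall_exists_index]
      rw [forall_comm]
      simp only [Set.forall_mem_image, map_rename, eval_rename, Function.comp_def]
    simp only [fiber, Set.mem_ofPred_eq, hP', forall_and, and_assoc]
    simp [g', map_rename, eval_rename, Finset.prod_ne_zero_iff, Function.comp_def, sub_eq_zero]
  have hsep (q) : Nonempty (Ω ↪ fiber P g q) ↔ ∃ i, (fiber P' (g' i) q).Nonempty := by
    constructor
    · rintro ⟨Z⟩
      have hne (a : {a : Ω × Ω // a.1 ≠ a.2}) : ∃ s, (Z a.1.1).1 s ≠ (Z a.1.2).1 s :=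
        Function.ne_iff.1 (Subtype.coe_ne_coe.2 (Z.injective.ne a.2))
      choose i hi using hne
      exact ⟨i, fun a => (Z a.1).1 a.2, (hfiber _ _ _).2 ⟨fun α => (Z α).2, hi⟩⟩
    · rintro ⟨i, Z, hZ⟩
      obtain ⟨hZ, hne⟩ := (hfiber _ _ _).1 hZ
      refine ⟨⟨fun α => ⟨_, hZ α⟩, fun α β h => by_contra fun hαβ => hne ⟨(α, β), hαβ⟩ ?_⟩⟩
      exact congrFun (congrArg Subtype.val h) _
  simp only [hsep, frequently_exists] at h ⊢
  obtain ⟨i, hi⟩ := h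
  exact (eventually_fiber_nonempty_of_frequently hi).mono fun q hq => ⟨i, hq⟩

theorem natCast_le_encard_iff {E : Type*} {m : ℕ} {s : Set E} :
    (m : ℕ∞) ≤ s.encard ↔ Nonempty (Fin m ↪ s) := by
  refine ⟨fun h => ?_, fun ⟨e⟩ => ?_⟩
  · obtain ⟨t, hts, ht⟩ := Set.exists_subset_encard_eq h
    have := (Set.finite_of_encard_eq_coe ht).fintype
    rw [← Set.coe_fintypeCard, Nat.cast_inj] at ht
    exact ⟨(Fintype.equivFinOfCardEq ht).symm.toEmbedding.trans (Set.embeddingOfSubset t s hts)⟩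
  · simpa using ENat.card_le_card_of_injective e.injective

theorem eventually_le_encard_fiber_of_frequently {m : ℕ}
    {P : Set (MvPolynomial σ (MvPolynomial κ K))} {g : MvPolynomial σ (MvPolynomial κ K)}
    (h : ∃ᶠ q in generic K κ, m ≤ (fiber P g q).encard) :
    ∀ᶠ q in generic K κ, m ≤ (fiber P g q).encard := by
  simp only [natCast_le_encard_iff] at h ⊢
  exact eventually_nonempty_embedding_fiber_of_frequently h

end Fiber

section UpperBound

variable {σ R : Type*} [CommRing R] {w : σ → ℕ} {n b : ℕ}

/-- The polynomials of total degree at most `n` all of whose monomials have `w`-weight at least `b`: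
the terms of weight `≥ b` in a filtration by weight that keeps control of the degree. -/
noncomputable def weightFiltration (R : Type*) [CommRing R] (w : σ → ℕ) (n b : ℕ) :
    Submodule R (MvPolynomial σ R) :=
  restrictSupport R {m | m.degree ≤ n ∧ b ≤ Finsupp.weight w m}

theorem weightFiltration_anti {b' : ℕ} (h : b' ≤ b) :
    weightFiltration R w n b ≤ weightFiltration R w n b' :=
  restrictSupport_mono R fun _ hm => ⟨hm.1, h.trans hm.2⟩

theorem weightFiltration_mono {n' : ℕ} (h : n ≤ n') :
    weightFiltration R w n b ≤ weightFiltration R w n' b :=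
  restrictSupport_mono R fun _ hm => ⟨hm.1.trans h, hm.2⟩

theorem monomial_mem_weightFiltration {m : σ →₀ ℕ} (a : R) (h : m.degree ≤ n)
    (h' : b ≤ Finsupp.weight w m) : monomial m a ∈ weightFiltration R w n b :=
  (monomial_mem_restrictSupport _).2 (Or.inl ⟨h, h'⟩)

theorem X_mem_weightFiltration {i : σ} (h : b ≤ w i) :
    (X i : MvPolynomial σ R) ∈ weightFiltration R w 1 b :=
  monomial_mem_weightFiltration _ (by simp) (by simpa [Finsupp.weight_single] using h)

theorem X_pow_mem_weightFiltration {i : σ} (n : ℕ) :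
    (X i ^ n : MvPolynomial σ R) ∈ weightFiltration R w n (n * w i) := by
  rw [X_pow_eq_monomial]
  exact monomial_mem_weightFiltration _ (by simp) (by simp [Finsupp.weight_single])

theorem mul_mem_weightFiltration {n' b' : ℕ} {p p' : MvPolynomial σ R}
    (hp : p ∈ weightFiltration R w n b) (hp' : p' ∈ weightFiltration R w n' b') :
    p * p' ∈ weightFiltration R w (n + n') (b + b') := by
  have h := Submodule.mul_mem_mul hp hp'
  rw [weightFiltration, weightFiltration, ← restrictSupport_add] at h
  refine restrictSupport_mono R ?_ h
  rintro _ ⟨m, hm, m', hm', rfl⟩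
  exact ⟨by simpa using add_le_add hm.1 hm'.1, by simpa using add_le_add hm.2 hm'.2⟩

theorem prod_mem_weightFiltration {ι : Type*} (f : ι → MvPolynomial σ R) (s : Finset ι)
    (hf : ∀ a ∈ s, f a ∈ weightFiltration R w 1 0) :
    ∏ a ∈ s, f a ∈ weightFiltration R w s.card 0 := by
  classical
  induction s using Finset.induction_on with
  | empty => exact monomial_mem_weightFiltration 1 (by simp) (by simp)
  | insert a s has ih =>
    rw [Finset.prod_insert has, Finset.card_insert_of_notMem has, add_comm]
    exact weightFiltration_anti (Nat.zero_le _)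
      (mul_mem_weightFiltration (hf a (by simp)) (ih fun b hb => hf b (by simp [hb])))

theorem prod_X_sub_sub_X_pow_mem {ι : Type*} {i : σ} (l : ι → MvPolynomial σ R)
    (hl : ∀ a, l a ∈ weightFiltration R w 1 (w i + 1)) (s : Finset ι) :
    ∏ a ∈ s, (X i - l a) - X i ^ s.card ∈ weightFiltration R w s.card (s.card * w i + 1) := by
  classical
  induction s using Finset.induction_on with
  | empty => simp
  | insert a s has ih =>
    rw [Finset.prod_insert has, Finset.card_insert_of_notMem has]
    have hfactor : X i - l a ∈ weightFiltration R w 1 (w i) :=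
      sub_mem (X_mem_weightFiltration le_rfl) (weightFiltration_anti (Nat.le_succ _) (hl a))
    have hsplit : (X i - l a) * ∏ a ∈ s, (X i - l a) - X i ^ (s.card + 1) =
        (∏ a ∈ s, (X i - l a) - X i ^ s.card) * (X i - l a) - X i ^ s.card * l a := by ring
    rw [hsplit]
    refine sub_mem ?_ ?_
    · exact weightFiltration_anti (le_of_eq (by ring)) (mul_mem_weightFiltration ih hfactor)
    · exact weightFiltration_anti (le_of_eq (by ring))
        (mul_mem_weightFiltration (X_pow_mem_weightFiltration _) (hl a))

theorem fg_weightFiltration [Finite σ] : (weightFiltration R w n b).FG := by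
  rw [weightFiltration, restrictSupport_eq_span]
  exact Submodule.fg_span (((Finsupp.finite_of_degree_le n).subset fun _ hm => hm.1).image _)

theorem exists_weightFiltration_eq_bot [Finite σ] (R : Type*) [CommRing R] (w : σ → ℕ) (n : ℕ) :
    ∃ b, weightFiltration R w n b = ⊥ := by
  obtain ⟨b, hb⟩ := ((Finsupp.finite_of_degree_le (σ := σ) n).image (Finsupp.weight w)).bddAbove
  refine ⟨b + 1, ?_⟩
  have hempty : {m : σ →₀ ℕ | m.degree ≤ n ∧ b + 1 ≤ Finsupp.weight w m} = ∅ :=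
    Set.eq_empty_of_forall_notMem fun m hm =>
      (Nat.lt_of_lt_of_le b.lt_succ_self hm.2).not_ge (hb (Set.mem_image_of_mem _ hm.1))
  rw [weightFiltration, restrictSupport_eq_span, hempty, Set.image_empty, Submodule.span_empty]

variable {d : σ → ℕ} {f : σ → MvPolynomial σ R} {I : Ideal R}

theorem monomial_mul_mem_sup {m : σ →₀ ℕ} {n' c : ℕ} {p : MvPolynomial σ R}
    (hp : p ∈ weightFiltration R w n' c ⊔ I • weightFiltration R w n' 0)
    (hn : m.degree + n' ≤ n) (hb : b ≤ Finsupp.weight w m + c) :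
    monomial m 1 * p ∈ weightFiltration R w n b ⊔ I • weightFiltration R w n 0 := by
  have hm : monomial m (1 : R) ∈ weightFiltration R w m.degree (Finsupp.weight w m) :=
    monomial_mem_weightFiltration _ le_rfl le_rfl
  obtain ⟨u, hu, v, hv, rfl⟩ := Submodule.mem_sup.1 hp
  rw [mul_add]
  refine add_mem (Submodule.mem_sup_left ?_) (Submodule.mem_sup_right ?_)
  · exact weightFiltration_anti hb (weightFiltration_mono hn (mul_mem_weightFiltration hm hu))
  · have hv' := Submodule.mem_map_of_mem (f := LinearMap.mulLeft R (monomial m 1)) hv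
    rw [Submodule.map_smul''] at hv'
    refine Submodule.smul_mono le_rfl (Submodule.map_le_iff_le_comap.2 fun u hu => ?_) hv'
    exact weightFiltration_anti (Nat.zero_le _)
      (weightFiltration_mono hn (mul_mem_weightFiltration hm hu))

theorem weightFiltration_le_sup_succ
    (hf : ∀ i, f i - X i ^ d i ∈ weightFiltration R w (d i) (d i * w i + 1) ⊔
      I • weightFiltration R w (d i) 0) (n b : ℕ) :
    weightFiltration R w n b ≤ restrictSupport R {m | ∀ i, m i < d i} ⊔
      (Ideal.span (Set.range f)).restrictScalars R ⊔
        (weightFiltration R w n (b + 1) ⊔ I • weightFiltration R w n 0) := by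
  conv_lhs => rw [weightFiltration, restrictSupport_eq_span]
  refine Submodule.span_le.2 ?_
  rintro _ ⟨m, ⟨hmn, hmb⟩, rfl⟩
  by_cases hmd : ∀ i, m i < d i
  · exact Submodule.mem_sup_left (Submodule.mem_sup_left
      ((monomial_mem_restrictSupport _).2 (Or.inl hmd)))
  push Not at hmd
  obtain ⟨i, hi⟩ := hmd
  obtain ⟨m', rfl⟩ : ∃ m', m = m' + Finsupp.single i (d i) :=
    ⟨m - Finsupp.single i (d i), (tsub_add_cancel_of_le (by simpa using hi)).symm⟩
  have hdivide : (monomial (m' + Finsupp.single i (d i)) 1 : MvPolynomial σ R) =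
      monomial m' 1 * f i - monomial m' 1 * (f i - X i ^ d i) := by
    rw [X_pow_eq_monomial, mul_sub, monomial_mul, mul_one]
    ring
  change monomial _ 1 ∈ _
  rw [hdivide]
  refine sub_mem (Submodule.mem_sup_left (Submodule.mem_sup_right ?_))
    (Submodule.mem_sup_right (monomial_mul_mem_sup (hf i) ?_ ?_))
  · exact Ideal.mul_mem_left _ _ (Ideal.subset_span (Set.mem_range_self i))
  · simpa using hmn
  · have : b ≤ Finsupp.weight w m' + d i * w i := by simpa [Finsupp.weight_single] using hmb
    omega

theorem weightFiltration_le_sup_smul [Finite σ]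
    (hf : ∀ i, f i - X i ^ d i ∈ weightFiltration R w (d i) (d i * w i + 1) ⊔
      I • weightFiltration R w (d i) 0) (n : ℕ) :
    weightFiltration R w n 0 ≤ restrictSupport R {m | ∀ i, m i < d i} ⊔
      (Ideal.span (Set.range f)).restrictScalars R ⊔ I • weightFiltration R w n 0 := by
  have hdescend (b : ℕ) : weightFiltration R w n 0 ≤ restrictSupport R {m | ∀ i, m i < d i} ⊔
      (Ideal.span (Set.range f)).restrictScalars R ⊔
        (weightFiltration R w n b ⊔ I • weightFiltration R w n 0) := by
    induction b with
    | zero => exact le_sup_of_le_right le_sup_left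
    | succ b ih =>
      refine ih.trans (sup_le le_sup_left (sup_le (weightFiltration_le_sup_succ hf n b) ?_))
      exact le_sup_of_le_right le_sup_right
  obtain ⟨b, hb⟩ := exists_weightFiltration_eq_bot R w n
  simpa only [hb, bot_sup_eq] using hdescend b

/- Nakayama's lemma turns division modulo `I` into division after inverting one element `≡ 1`. -/
theorem exists_smul_mem_sup [Finite σ]
    (hf : ∀ i, f i - X i ^ d i ∈ weightFiltration R w (d i) (d i * w i + 1) ⊔
      I • weightFiltration R w (d i) 0) (n : ℕ) :
    ∃ a : R, a - 1 ∈ I ∧ ∀ p ∈ weightFiltration R w n 0,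
      a • p ∈ restrictSupport R {m | ∀ i, m i < d i} ⊔
        (Ideal.span (Set.range f)).restrictScalars R := by
  set 𝒟 := restrictSupport R {m | ∀ i, m i < d i} ⊔ (Ideal.span (Set.range f)).restrictScalars R
  have hle := Submodule.map_mono (f := 𝒟.mkQ) (weightFiltration_le_sup_smul hf n)
  rw [Submodule.map_sup, Submodule.map_smul'', Submodule.mkQ_map_self, bot_sup_eq] at hle
  obtain ⟨a, haI, ha⟩ := Submodule.exists_sub_one_mem_and_smul_eq_zero_of_fg_of_le_smul I _
    (fg_weightFiltration.map _) hle
  refine ⟨a, haI, fun p hp => (Submodule.Quotient.mk_eq_zero 𝒟).1 ?_⟩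
  exact ha _ (Submodule.mem_map_of_mem hp)

theorem restrictSupport_sup_eq_top {B : Set (σ →₀ ℕ)} (J : Ideal (MvPolynomial σ R)) (n : ℕ)
    (hB : ∀ m ∈ B, m.degree ≤ n) (h : ∀ m : σ →₀ ℕ, m.degree ≤ n + 1 →
      monomial m 1 ∈ restrictSupport R B ⊔ J.restrictScalars R) :
    restrictSupport R B ⊔ J.restrictScalars R = ⊤ := by
  refine Submodule.eq_top_iff'.2 fun p => ?_
  induction p using MvPolynomial.induction_on with
  | C a =>
    have := Submodule.smul_mem _ a (h 0 (by simp))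
    rwa [smul_monomial, smul_eq_mul, mul_one, ← C_apply] at this
  | add p q hp hq => exact add_mem hp hq
  | mul_X p i hp =>
    obtain ⟨v, hv, u, hu, rfl⟩ := Submodule.mem_sup.1 hp
    rw [add_mul]
    refine add_mem ?_ (Submodule.mem_sup_right (J.mul_mem_right _ hu))
    suffices restrictSupport R B ≤
        (restrictSupport R B ⊔ J.restrictScalars R).comap (LinearMap.mulRight R (X i)) from this hv
    conv_lhs => rw [restrictSupport_eq_span]
    refine Submodule.span_le.2 ?_
    rintro _ ⟨m, hm, rfl⟩
    simpa [X, monomial_mul] using h (m + Finsupp.single i 1) (by simpa using hB m hm)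

theorem map_mem_restrictSupport {S : Type*} [CommRing S] (ε : R →+* S) {B : Set (σ →₀ ℕ)}
    {p : MvPolynomial σ R} (hp : p ∈ restrictSupport R B) : map ε p ∈ restrictSupport S B :=
  (mem_restrictSupport_iff _).2
    (Set.Subset.trans (support_map_subset _ _) ((mem_restrictSupport_iff _).1 hp))

theorem encard_zeros_le_of_sup_eq_top {K : Type*} [Field K] {B : Set (σ →₀ ℕ)} (hB : B.Finite)
    {ι : Type*} {f : ι → MvPolynomial σ K}
    (h : restrictSupport K B ⊔ (Ideal.span (Set.range f)).restrictScalars K = ⊤) :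
    {z | ∀ i, eval z (f i) = 0}.encard ≤ B.encard := by
  have := hB.to_subtype
  have : Module.Finite K (restrictSupport K B) := .of_basis (basisRestrictSupport K B)
  let π := (Ideal.Quotient.mkₐ K (Ideal.span (Set.range f))).toLinearMap.domRestrict
    (restrictSupport K B)
  have hπ : Function.Surjective π := by
    intro x
    obtain ⟨p, rfl⟩ := Ideal.Quotient.mk_surjective x
    obtain ⟨v, hv, u, hu, rfl⟩ := Submodule.mem_sup.1 (h.ge (Submodule.mem_top (x := p)))
    refine ⟨⟨v, hv⟩, Ideal.Quotient.eq.2 ?_⟩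
    simpa using hu
  have : Module.Finite K (MvPolynomial σ K ⧸ Ideal.span (Set.range f)) := .of_surjective π hπ
  rw [encard_zeros_eq_card_algHom, ENat.card_eq_coe_natCard, ← hB.cast_ncard_eq, Nat.cast_le]
  calc Nat.card (MvPolynomial σ K ⧸ Ideal.span (Set.range f) →ₐ[K] K)
      ≤ Module.finrank K (MvPolynomial σ K ⧸ Ideal.span (Set.range f)) :=
        card_algHom_le_finrank K _ K
    _ ≤ Module.finrank K (restrictSupport K B) := LinearMap.finrank_le_finrank_of_surjective hπ
    _ = B.ncard := Module.finrank_eq_nat_card_basis (basisRestrictSupport K B)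

theorem encard_setOf_forall_lt [Fintype σ] (d : σ → ℕ) :
    {m : σ →₀ ℕ | ∀ i, m i < d i}.encard = (∏ i, d i : ℕ) := by
  let e : {m : σ →₀ ℕ | ∀ i, m i < d i} ≃ ((i : σ) → Fin (d i)) :=
    { toFun := fun m i => ⟨m.1 i, m.2 i⟩
      invFun := fun g => ⟨Finsupp.equivFunOnFinite.symm fun i => (g i : ℕ), fun i => by simp⟩
      left_inv := fun m => by ext; simp
      right_inv := fun g => by ext; simp }
  classical
  rw [Set.encard, ENat.card_congr e, ENat.card_eq_coe_fintype_card]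
  simp

theorem eventually_encard_zeros_le [Fintype σ] {K κ : Type*} [Field K] {w d : σ → ℕ}
    {f : σ → MvPolynomial σ (MvPolynomial κ K)}
    (hf : ∀ i, f i - X i ^ d i ∈ weightFiltration _ w (d i) (d i * w i + 1) ⊔
      RingHom.ker (constantCoeff (σ := κ) (R := K)) • weightFiltration _ w (d i) 0) :
    ∀ᶠ q in generic K κ, {z | ∀ i, eval z (map (eval q) (f i)) = 0}.encard ≤ (∏ i, d i : ℕ) := by
  obtain ⟨a, ha, hmem⟩ := exists_smul_mem_sup hf (∑ i, d i + 1)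
  have ha0 : a ≠ 0 := by
    rintro rfl
    simp [RingHom.mem_ker] at ha
  refine eventually_generic_iff.2 ⟨a, ha0, fun q hq => ?_⟩
  have hcard := encard_setOf_forall_lt d
  rw [← hcard]
  refine encard_zeros_le_of_sup_eq_top (Set.finite_of_encard_eq_coe hcard)
    (restrictSupport_sup_eq_top _ (∑ i, d i) (fun m hm => ?_) fun m hm => ?_)
  · rw [Finsupp.degree_eq_sum]
    exact Finset.sum_le_sum fun i _ => (hm i).le
  · obtain ⟨v, hv, u, hu, huv⟩ := Submodule.mem_sup.1
      (hmem _ (monomial_mem_weightFiltration 1 hm (Nat.zero_le _)))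
    have hmap : map (eval q) v + map (eval q) u = eval q a • monomial m 1 := by
      rw [← map_add, huv, smul_monomial, map_monomial, smul_monomial, smul_eq_mul, mul_one,
        smul_eq_mul, mul_one]
    rw [← Submodule.smul_mem_iff _ hq, ← hmap]
    refine add_mem (Submodule.mem_sup_left (map_mem_restrictSupport _ hv))
      (Submodule.mem_sup_right ?_)
    have hu' := Ideal.mem_map_of_mem (MvPolynomial.map (eval q)) hu
    rwa [Ideal.map_span, ← Set.range_comp] at hu'

end UpperBound

section BezoutBound

variable {k : ℕ} {r : ℕ → ℕ}

/-- The system in which the parameters `q` are indeterminates. -/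
noncomputable def genericEqn (k : ℕ) (r : ℕ → ℕ) (i : Idx k r) :
    MvPolynomial (Idx k r) (MvPolynomial (Fin k) ℂ) :=
  ∏ a : Fin (r (i.1 + 2)), (X i - map C (levelVar k r (i.1 + 2) a))
    - C (X i.1) * ∏ b : Fin (r i.1), (X i - map C (levelVar k r i.1 b))

theorem map_eval_map_C {K κ σ : Type*} [CommRing K] (q : κ → K) (p : MvPolynomial σ K) :
    MvPolynomial.map (eval q) (MvPolynomial.map C p) = p := by
  have hC : (eval q).comp (C : K →+* MvPolynomial κ K) = RingHom.id K := by ext; simp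
  rw [MvPolynomial.map_map, hC, MvPolynomial.map_id]

theorem map_genericEqn (q : Fin k → ℂ) (i : Idx k r) :
    map (eval q) (genericEqn k r i) = eqn k r q i := by
  simp only [genericEqn, eqn, map_sub, map_mul, map_prod, map_X, map_C, eval_X, map_eval_map_C]

variable (k) in
theorem levelVar_eq_zero_or_eq_X (j : ℕ) (a : Fin (r j)) :
    levelVar k r j a = 0 ∨ ∃ i : Idx k r, (i.1 : ℕ) + 1 = j ∧ levelVar k r j a = X i := by
  cases j with
  | zero => exact Or.inl rfl
  | succ j =>
    rw [levelVar]
    split_ifs with hj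
    · exact Or.inr ⟨⟨⟨j, hj⟩, a⟩, rfl, rfl⟩
    · exact Or.inl rfl

theorem map_C_levelVar_mem_weightFiltration {j b : ℕ} (a : Fin (r j)) (hb : b ≤ j - 1) :
    map C (levelVar k r j a) ∈
      weightFiltration (MvPolynomial (Fin k) ℂ) (fun i : Idx k r => (i.1 : ℕ)) 1 b := by
  obtain h | ⟨i, hi, h⟩ := levelVar_eq_zero_or_eq_X k j a
  · simp [h]
  · rw [h, map_X]
    exact X_mem_weightFiltration (by omega)

theorem genericEqn_sub_X_pow_mem {i : Idx k r} (hr : r i.1 ≤ r (i.1 + 2)) :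
    genericEqn k r i - X i ^ r (i.1 + 2) ∈
      weightFiltration _ (fun i : Idx k r => (i.1 : ℕ)) (r (i.1 + 2)) (r (i.1 + 2) * i.1 + 1) ⊔
        RingHom.ker (constantCoeff (σ := Fin k) (R := ℂ)) •
          weightFiltration _ (fun i : Idx k r => (i.1 : ℕ)) (r (i.1 + 2)) 0 := by
  rw [genericEqn, sub_right_comm]
  refine sub_mem (Submodule.mem_sup_left ?_) (Submodule.mem_sup_right ?_)
  · simpa using prod_X_sub_sub_X_pow_mem (w := fun i : Idx k r => (i.1 : ℕ)) (i := i)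
      (fun a => map C (levelVar k r (i.1 + 2) a))
      (fun a => map_C_levelVar_mem_weightFiltration a le_rfl) Finset.univ
  · rw [C_mul']
    refine Submodule.smul_mem_smul (by simp [RingHom.mem_ker]) (weightFiltration_mono hr ?_)
    simpa using prod_mem_weightFiltration (w := fun i : Idx k r => (i.1 : ℕ))
      (fun b : Fin (r i.1) => X i - map C (levelVar k r i.1 b)) Finset.univ fun b _ =>
        sub_mem (X_mem_weightFiltration (Nat.zero_le _))
          (map_C_levelVar_mem_weightFiltration b (Nat.zero_le _))

theorem eventually_encard_solutions_le (hr : ∀ j < k, r j ≤ r (j + 2)) :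
    ∀ᶠ q in generic ℂ (Fin k),
      (solutions k r q).encard ≤ (∏ i : Idx k r, r (i.1 + 2) : ℕ) := by
  have h := eventually_encard_zeros_le fun i : Idx k r => genericEqn_sub_X_pow_mem (hr _ i.1.2)
  simp only [map_genericEqn] at h
  exact h

end BezoutBound

section Degeneration

variable {k : ℕ} {r : ℕ → ℕ}

/-- The value of the polynomial `levelVar k r j a`, that is of `z_{a,j}`, at the point `y`. -/
noncomputable def level (y : Idx k r → ℂ) (j : ℕ) (a : Fin (r j)) : ℂ :=
  eval y (levelVar k r j a)

theorem level_succ (y : Idx k r → ℂ) {j : ℕ} (hj : j < k) (a : Fin (r (j + 1))) :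
    level y (j + 1) a = y ⟨⟨j, hj⟩, a⟩ := by
  simp [level, levelVar, hj]

theorem eval_eqn (q : Fin k → ℂ) (y : Idx k r → ℂ) (i : Idx k r) :
    eval y (eqn k r q i) = ∏ a : Fin (r (i.1 + 2)), (y i - level y (i.1 + 2) a)
      - q i.1 * ∏ b : Fin (r i.1), (y i - level y i.1 b) := by
  simp [eqn, level]

theorem level_pow_mul (t : ℂ) (y : Idx k r → ℂ) (j : ℕ) (a : Fin (r j)) :
    level (fun i => t ^ (i.1 + 1 : ℕ) * y i) j a = t ^ j * level y j a := by
  obtain h | ⟨i, hi, h⟩ := levelVar_eq_zero_or_eq_X k j a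
  · simp [level, h]
  · simp [level, h, ← hi]

theorem level_add_smul (y η : Idx k r → ℂ) (u : ℂ) (j : ℕ) (a : Fin (r j)) :
    level (y + u • η) j a = level y j a + u * level η j a := by
  obtain h | ⟨i, -, h⟩ := levelVar_eq_zero_or_eq_X k j a <;> simp [level, h]

theorem contDiff_level (j : ℕ) (a : Fin (r j)) :
    ContDiff ℂ 1 fun x : ℂ × (Idx k r → ℂ) => level x.2 j a := by
  obtain h | ⟨i, -, h⟩ := levelVar_eq_zero_or_eq_X k j a
  · simpa [level, h] using contDiff_const
  · simp only [level, h, eval_X]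
    fun_prop

/-- The system in the coordinates `y_{s,j} = t ^ (-j) z_{s,j}`, divided by a power of `t`, for the
parameters `q_j = c_j t ^ (j r_{j+1} - (j-1) r_{j-1})`. -/
noncomputable def scaledEqn (c : Fin k → ℂ) (t : ℂ) (y : Idx k r → ℂ) (i : Idx k r) : ℂ :=
  ∏ a : Fin (r (i.1 + 2)), (y i - t * level y (i.1 + 2) a)
    - c i.1 * ∏ b : Fin (r i.1), (t * y i - level y i.1 b)

theorem eval_eqn_pow_mul {i : Idx k r} (hr : r i.1 ≤ r (i.1 + 2)) (c : Fin k → ℂ) (t : ℂ)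
    (y : Idx k r → ℂ) :
    eval (fun i => t ^ (i.1 + 1 : ℕ) * y i)
        (eqn k r (fun j => c j * t ^ ((j + 1) * r (j + 2) - j * r j)) i) =
      t ^ ((i.1 + 1) * r (i.1 + 2)) * scaledEqn c t y i := by
  obtain ⟨e, he⟩ : ∃ e, (i.1 + 1) * r (i.1 + 2) = e + i.1 * r i.1 :=
    ⟨_, (Nat.sub_add_cancel (Nat.mul_le_mul (Nat.le_succ _) hr)).symm⟩
  have hupper (a) : t ^ (i.1 + 1 : ℕ) * y i - t ^ (i.1 + 2 : ℕ) * level y (i.1 + 2) a =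
      t ^ (i.1 + 1 : ℕ) * (y i - t * level y (i.1 + 2) a) := by ring
  have hlower (b) : t ^ (i.1 + 1 : ℕ) * y i - t ^ (i.1 : ℕ) * level y i.1 b =
      t ^ (i.1 : ℕ) * (t * y i - level y i.1 b) := by ring
  simp only [eval_eqn, level_pow_mul, hupper, hlower, Finset.prod_mul_distrib, Finset.prod_const,
    Finset.card_univ, Fintype.card_fin, ← pow_mul, scaledEqn]
  rw [he, Nat.add_sub_cancel]
  ring

theorem scaledEqn_zero (c : Fin k → ℂ) (y : Idx k r → ℂ) (i : Idx k r) :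
    scaledEqn c 0 y i = y i ^ r (i.1 + 2) - c i.1 * ∏ b : Fin (r i.1), -level y i.1 b := by
  simp [scaledEqn]

theorem contDiff_scaledEqn (c : Fin k → ℂ) :
    ContDiff ℂ 1 fun x : ℂ × (Idx k r → ℂ) => scaledEqn c x.1 x.2 := by
  refine contDiff_pi.2 fun i => ?_
  have := contDiff_level (k := k) (r := r)
  unfold scaledEqn
  fun_prop

theorem prod_level_comp_sigmaCongrRight {M : Type*} [CommMonoid M]
    (ρ : (j : Fin k) → Equiv.Perm (Fin (r (j + 1)))) (y : Idx k r → ℂ) (g : ℂ → M) (j : ℕ) :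
    ∏ a, g (level (y ∘ Equiv.sigmaCongrRight ρ) j a) = ∏ a, g (level y j a) := by
  cases j with
  | zero => simp [level, levelVar]
  | succ j =>
    by_cases h : j < k
    · simp only [level_succ _ h]
      exact Equiv.prod_comp (ρ ⟨j, h⟩) fun a => g (y ⟨⟨j, h⟩, a⟩)
    · simp [level, levelVar, h]

theorem scaledEqn_comp_sigmaCongrRight (ρ : (j : Fin k) → Equiv.Perm (Fin (r (j + 1))))
    (c : Fin k → ℂ) (t : ℂ) (y : Idx k r → ℂ) :
    scaledEqn c t (y ∘ Equiv.sigmaCongrRight ρ) = scaledEqn c t y ∘ Equiv.sigmaCongrRight ρ := by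
  funext i
  simp only [scaledEqn]
  rw [prod_level_comp_sigmaCongrRight ρ y fun x => (y ∘ Equiv.sigmaCongrRight ρ) i - t * x,
    prod_level_comp_sigmaCongrRight ρ y fun x => t * (y ∘ Equiv.sigmaCongrRight ρ) i - x]
  rfl

theorem apply_eq_zero_of_hasLineDerivAt_scaledEqn_zero {c : Fin k → ℂ} {y η : Idx k r → ℂ}
    {i : Idx k r} (hpos : r (i.1 + 2) ≠ 0) (hy : y i ≠ 0) (hη : ∀ b, level η i.1 b = 0)
    (h : HasLineDerivAt ℂ (fun y => scaledEqn c 0 y i) 0 y η) : η i = 0 := by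
  have hpow : HasDerivAt (fun u : ℂ => (y i + u * η i) ^ r (i.1 + 2))
      (r (i.1 + 2) * y i ^ (r (i.1 + 2) - 1) * η i) 0 := by
    simpa using (((hasDerivAt_id' (0 : ℂ)).mul_const (η i)).const_add (y i)).fun_pow (r (i.1 + 2))
  have hline := hpow.sub_const (c i.1 * ∏ b : Fin (r i.1), -level y i.1 b)
  simp only [HasLineDerivAt, scaledEqn_zero, level_add_smul, hη, mul_zero, add_zero] at h
  simpa [hpos, hy] using hline.unique h

theorem eq_zero_of_hasLineDerivAt_scaledEqn_zero {c : Fin k → ℂ} {y η : Idx k r → ℂ}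
    (hpos : ∀ i : Idx k r, r (i.1 + 2) ≠ 0) (hy : ∀ i, y i ≠ 0)
    (h : ∀ i, HasLineDerivAt ℂ (fun y => scaledEqn c 0 y i) 0 y η) : η = 0 := by
  have hlevel (j : ℕ) : ∀ a : Fin (r j), level η j a = 0 := by
    induction j with
    | zero => simp [level, levelVar]
    | succ j ih =>
      intro a
      by_cases hj : j < k
      · rw [level_succ _ hj]
        exact apply_eq_zero_of_hasLineDerivAt_scaledEqn_zero (hpos _) (hy _) ih (h _)
      · simp [level, levelVar, hj]
  funext i
  simpa [level_succ _ i.1.2] using hlevel (i.1 + 1) i.2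

theorem isInvertible_fderiv_scaledEqn_comp_inr {c : Fin k → ℂ} {y : Idx k r → ℂ}
    (hpos : ∀ i : Idx k r, r (i.1 + 2) ≠ 0) (hy : ∀ i, y i ≠ 0) :
    (fderiv ℂ (fun x : ℂ × (Idx k r → ℂ) => scaledEqn c x.1 x.2) (0, y) ∘L
      .inr ℂ ℂ (Idx k r → ℂ)).IsInvertible := by
  set L := fderiv ℂ (fun x : ℂ × (Idx k r → ℂ) => scaledEqn c x.1 x.2) (0, y) ∘L
    .inr ℂ ℂ (Idx k r → ℂ)
  have hL : HasFDerivAt (fun y : Idx k r → ℂ => scaledEqn c 0 y) L y :=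
    ((contDiff_scaledEqn c).differentiable one_ne_zero (0, y)).hasFDerivAt.comp y
      (hasFDerivAt_prodMk_right 0 y)
  have hinj : Function.Injective L := by
    rw [injective_iff_map_eq_zero]
    intro η hη
    refine eq_zero_of_hasLineDerivAt_scaledEqn_zero (c := c) hpos hy fun i => ?_
    simpa [hη] using (hasFDerivAt_pi'.1 hL i).hasLineDerivAt η
  exact ⟨(LinearEquiv.ofInjectiveEndo L.toLinearMap hinj).toContinuousLinearEquiv, by ext; rfl⟩

theorem comp_sigmaCongrRight_mulSingle_swap_eq_self_iff {E : Type*} {y : Idx k r → E} {j : Fin k}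
    {s u : Fin (r (j + 1))} :
    y ∘ Equiv.sigmaCongrRight
        (Pi.mulSingle (M := fun j : Fin k => Equiv.Perm (Fin (r (j + 1)))) j (Equiv.swap s u)) = y ↔
      y ⟨j, s⟩ = y ⟨j, u⟩ := by
  refine ⟨fun h => by simpa using (congrFun h ⟨j, s⟩).symm, fun h => ?_⟩
  funext ⟨j', a⟩
  by_cases hj : j' = j
  · subst hj
    simp only [Function.comp_apply, Equiv.sigmaCongrRight_apply, Pi.mulSingle_eq_same,
      Equiv.swap_apply_def]
    split_ifs <;> simp_all
  · simp [Pi.mulSingle_eq_of_ne hj]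

theorem eventually_ne_of_tendsto {D E : Type*} [TopologicalSpace E] [T2Space E] {l : Filter D}
    {f g : D → E} {a b : E} (hf : Tendsto f l (𝓝 a)) (hg : Tendsto g l (𝓝 b)) (hab : a ≠ b) :
    ∀ᶠ x in l, f x ≠ g x :=
  (hf.prodMk_nhds hg).eventually (isClosed_diagonal.isOpen_compl.mem_nhds hab)

theorem exists_tendsto_eventually_scaledEqn_eq_zero {c : Fin k → ℂ} {y : Idx k r → ℂ}
    (hpos : ∀ i : Idx k r, r (i.1 + 2) ≠ 0) (hy : ∀ i, y i ≠ 0) (hy0 : scaledEqn c 0 y = 0) :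
    ∃ ψ : ℂ → Idx k r → ℂ, Tendsto ψ (𝓝 0) (𝓝 y) ∧ ∀ᶠ t in 𝓝 0, scaledEqn c t (ψ t) = 0 ∧
      ∀ (j : Fin k) (s u : Fin (r (j + 1))), ψ t ⟨j, s⟩ = ψ t ⟨j, u⟩ ↔ y ⟨j, s⟩ = y ⟨j, u⟩ := by
  have hd := (contDiff_scaledEqn (r := r) c).contDiffAt.hasStrictFDerivAt (x := (0, y)) one_ne_zero
  have hinv := isInvertible_fderiv_scaledEqn_comp_inr (c := c) hpos hy
  set ψ := hd.implicitFunctionOfProdDomain hinv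
  have hψ : Tendsto ψ (𝓝 0) (𝓝 y) := hd.tendsto_implicitFunctionOfProdDomain hinv
  have hψ0 : ∀ᶠ t in 𝓝 0, scaledEqn c t (ψ t) = 0 := by
    simpa [hy0] using hd.eventually_apply_implicitFunctionOfProdDomain hinv
  refine ⟨ψ, hψ, hψ0.and ?_⟩
  simp only [eventually_all]
  intro j s u
  by_cases h : y ⟨j, s⟩ = y ⟨j, u⟩
  · -- Swapping the two coordinates yields another solution near `y`, so uniqueness applies.
    let ρ := Equiv.sigmaCongrRight
      (Pi.mulSingle (M := fun j : Fin k => Equiv.Perm (Fin (r (j + 1)))) j (Equiv.swap s u))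
    have hρ : Tendsto (fun t => (t, ψ t ∘ ρ)) (𝓝 0) (𝓝 (0, y)) := by
      have hcomp : Continuous fun z : Idx k r → ℂ => z ∘ ρ := by fun_prop
      have := (hcomp.tendsto y).comp hψ
      rw [comp_sigmaCongrRight_mulSingle_swap_eq_self_iff.2 h] at this
      exact tendsto_id.prodMk_nhds this
    filter_upwards [hψ0, hρ.eventually
      (hd.eventually_apply_eq_iff_implicitFunctionOfProdDomain hinv)] with t ht hunique
    refine iff_of_true (comp_sigmaCongrRight_mulSingle_swap_eq_self_iff.1 (hunique.1 ?_).symm) h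
    rw [scaledEqn_comp_sigmaCongrRight, ht, hy0]
    rfl
  · have hψ' := tendsto_pi_nhds.1 hψ
    filter_upwards [eventually_ne_of_tendsto (hψ' _) (hψ' _) h] with t ht
    exact iff_of_false ht h

end Degeneration

section LimitPoints

/-- The `i`-th complex `n`-th root of `a`, in the enumeration by the powers of a primitive `n`-th
root of unity. -/
noncomputable def nthRoot {n : ℕ} (a : ℂ) (i : Fin n) : ℂ :=
  Complex.exp (2 * Real.pi * Complex.I / n) ^ (i : ℕ) * a ^ ((n : ℂ)⁻¹)

theorem nthRoot_pow {n : ℕ} (a : ℂ) (i : Fin n) : nthRoot a i ^ n = a := by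
  have hn : n ≠ 0 := i.pos.ne'
  rw [nthRoot, mul_pow, pow_right_comm, (Complex.isPrimitiveRoot_exp n hn).pow_eq_one, one_pow,
    one_mul, Complex.cpow_nat_inv_pow a hn]

theorem nthRoot_ne_zero {n : ℕ} {a : ℂ} (ha : a ≠ 0) (i : Fin n) : nthRoot a i ≠ 0 :=
  ne_zero_pow i.pos.ne' (by rwa [nthRoot_pow])

theorem nthRoot_injective {n : ℕ} {a : ℂ} (ha : a ≠ 0) :
    Function.Injective (nthRoot a : Fin n → ℂ) := by
  intro i j hij
  have hroot : a ^ ((n : ℂ)⁻¹) ≠ 0 := right_ne_zero_of_mul (nthRoot_ne_zero ha i)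
  exact Fin.ext ((Complex.isPrimitiveRoot_exp n i.pos.ne').pow_inj i.2 j.2
    (mul_right_cancel₀ hroot hij))

/-- A choice, for each variable `z_{s,j}`, of one of the `r_{j+1}` roots to be extracted in the
limit system. -/
abbrev RootChoice (k : ℕ) (r : ℕ → ℕ) : Type := (i : Idx k r) → Fin (r (i.1 + 2))

variable {k : ℕ} {r : ℕ → ℕ} {c : Fin k → ℂ} {α β : RootChoice k r}

/-- Level `j` of the solution `limitPoint c α` of the limit system
`y_{s,j} ^ r_{j+1} = c_j ∏ b, (-y_{b,j-1})`, computed by extracting roots level by level. -/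
noncomputable def limitLevel (c : Fin k → ℂ) (α : RootChoice k r) : (j : ℕ) → Fin (r j) → ℂ
  | 0, _ => 0
  | j + 1, s => if h : j < k then
      nthRoot (c ⟨j, h⟩ * ∏ b : Fin (r j), -limitLevel c α j b) (α ⟨⟨j, h⟩, s⟩) else 0

/-- The solution of the limit system given by the choice of roots `α`. -/
noncomputable def limitPoint (c : Fin k → ℂ) (α : RootChoice k r) (i : Idx k r) : ℂ :=
  limitLevel c α (i.1 + 1) i.2

theorem level_limitPoint (j : ℕ) (a : Fin (r j)) :
    level (limitPoint c α) j a = limitLevel c α j a := by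
  cases j with
  | zero => simp [level, levelVar, limitLevel]
  | succ j =>
    by_cases h : j < k
    · rw [level_succ _ h, limitPoint]
    · simp [level, levelVar, limitLevel, h]

theorem limitPoint_eq (i : Idx k r) : limitPoint c α i =
    nthRoot (c i.1 * ∏ b : Fin (r i.1), -level (limitPoint c α) i.1 b) (α i) := by
  simp only [level_limitPoint]
  rw [limitPoint, limitLevel, dif_pos i.1.2]

theorem scaledEqn_zero_limitPoint : scaledEqn c 0 (limitPoint c α) = 0 := by
  funext i
  rw [scaledEqn_zero, limitPoint_eq i, nthRoot_pow, sub_self, Pi.zero_apply]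

theorem mul_prod_neg_level_limitPoint_ne_zero (h0 : r 0 = 0) (hc : ∀ j, c j ≠ 0) (j : Fin k) :
    c j * ∏ b : Fin (r j), -level (limitPoint c α) j b ≠ 0 := by
  obtain ⟨j, hj⟩ := j
  refine mul_ne_zero (hc _) (Finset.prod_ne_zero_iff.2 fun b _ => neg_ne_zero.2 ?_)
  induction j with
  | zero => exact absurd b.pos (by simp [h0])
  | succ j ih =>
    have hj' : j < k := j.lt_succ_self.trans hj
    rw [level_succ _ hj', limitPoint_eq]
    exact nthRoot_ne_zero (mul_ne_zero (hc _) (Finset.prod_ne_zero_iff.2 fun b hb =>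
      neg_ne_zero.2 (ih hj' b hb))) _

theorem limitPoint_ne_zero (h0 : r 0 = 0) (hc : ∀ j, c j ≠ 0) (i : Idx k r) :
    limitPoint c α i ≠ 0 := by
  rw [limitPoint_eq]
  exact nthRoot_ne_zero (mul_prod_neg_level_limitPoint_ne_zero h0 hc _) _

theorem limitPoint_eq_iff (h0 : r 0 = 0) (hc : ∀ j, c j ≠ 0) {j : Fin k} {s u : Fin (r (j + 1))} :
    limitPoint c α ⟨j, s⟩ = limitPoint c α ⟨j, u⟩ ↔ α ⟨j, s⟩ = α ⟨j, u⟩ := by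
  rw [limitPoint_eq, limitPoint_eq]
  exact (nthRoot_injective (mul_prod_neg_level_limitPoint_ne_zero h0 hc j)).eq_iff

theorem limitPoint_injective (h0 : r 0 = 0) (hc : ∀ j, c j ≠ 0) :
    Function.Injective (limitPoint c : RootChoice k r → Idx k r → ℂ) := by
  intro α β h
  funext i
  have hi : limitPoint c α i = limitPoint c β i := congrFun h i
  rw [limitPoint_eq, limitPoint_eq, h] at hi
  exact nthRoot_injective (mul_prod_neg_level_limitPoint_ne_zero h0 hc i.1) hi

variable (k r) in
/-- The choices of roots that are pairwise distinct on each level, which are those producing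
non-degenerate solutions. -/
def distinctChoices : Set (RootChoice k r) :=
  {α | ∀ (j : Fin k) (s u : Fin (r (j + 1))), s ≠ u → α ⟨j, s⟩ ≠ α ⟨j, u⟩}

theorem exists_tendsto_eventually_nonDegenerate_iff (h0 : r 0 = 0) (hc : ∀ j, c j ≠ 0)
    (α : RootChoice k r) :
    ∃ ψ : ℂ → Idx k r → ℂ, Tendsto ψ (𝓝 0) (𝓝 (limitPoint c α)) ∧
      ∀ᶠ t in 𝓝 0, scaledEqn c t (ψ t) = 0 ∧ (NonDegenerate (ψ t) ↔ α ∈ distinctChoices k r) := by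
  obtain ⟨ψ, hψ, h⟩ := exists_tendsto_eventually_scaledEqn_eq_zero (fun i => (α i).pos.ne')
    (limitPoint_ne_zero h0 hc) (scaledEqn_zero_limitPoint (α := α))
  refine ⟨ψ, hψ, h.mono fun t ht => ⟨ht.1, ?_⟩⟩
  simp only [NonDegenerate, distinctChoices, Set.mem_ofPred_eq, ne_eq, ht.2,
    limitPoint_eq_iff h0 hc]

theorem frequently_exists_injective_solutions (h0 : r 0 = 0) (hr : ∀ j < k, r j ≤ r (j + 2)) :
    ∃ᶠ q in generic ℂ (Fin k), ∃ Z : RootChoice k r → Idx k r → ℂ, Function.Injective Z ∧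
      ∀ α, Z α ∈ solutions k r q ∧ (NonDegenerate (Z α) ↔ α ∈ distinctChoices k r) := by
  refine frequently_generic_of_frequently_cofinite
    (fun j : Fin k => (j + 1) * r (j + 2) - j * r j) fun c hc => ?_
  choose ψ hψ hsol using exists_tendsto_eventually_nonDegenerate_iff h0 hc (r := r)
  have hinj : ∀ᶠ t in 𝓝 0, Function.Injective fun α => ψ α t := by
    simp only [Function.Injective, eventually_all]
    intro α β
    by_cases hαβ : α = β
    · exact .of_forall fun _ _ => hαβ
    · filter_upwards [eventually_ne_of_tendsto (hψ α) (hψ β)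
        ((limitPoint_injective h0 hc).ne hαβ)] with t ht using fun h => absurd h ht
  have hnhds : ∀ᶠ t in 𝓝[≠] (0 : ℂ), t ≠ 0 ∧ (Function.Injective fun α => ψ α t) ∧
      ∀ α, scaledEqn c t (ψ α t) = 0 ∧ (NonDegenerate (ψ α t) ↔ α ∈ distinctChoices k r) :=
    eventually_mem_nhdsWithin.and ((hinj.and (eventually_all.2 hsol)).filter_mono
      nhdsWithin_le_nhds)
  refine (hnhds.frequently.filter_mono (nhdsNE_le_cofinite 0)).mono ?_
  rintro t ⟨ht, htinj, htsol⟩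
  refine ⟨fun α i => t ^ (i.1 + 1 : ℕ) * ψ α t i, fun α β h => htinj (funext fun i => ?_),
    fun α => ⟨fun i => ?_, ?_⟩⟩
  · exact mul_left_cancel₀ (pow_ne_zero _ ht) (congrFun h i)
  · rw [eval_eqn_pow_mul (hr _ i.1.2), (htsol α).1, Pi.zero_apply, mul_zero]
  · rw [← (htsol α).2]
    simp [NonDegenerate, ht]

end LimitPoints

section Counting

variable {k : ℕ} {r : ℕ → ℕ}

variable (k r) in
/-- The discriminant polynomial whose nonvanishing expresses non-degeneracy. -/
noncomputable def levelDiscr : MvPolynomial (Idx k r) ℂ :=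
  ∏ j : Fin k, ∏ s : Fin (r (j + 1)), ∏ u ∈ {s}ᶜ, (X ⟨j, s⟩ - X ⟨j, u⟩)

theorem eval_levelDiscr_ne_zero_iff (z : Idx k r → ℂ) :
    eval z (levelDiscr k r) ≠ 0 ↔ NonDegenerate z := by
  simp only [levelDiscr, NonDegenerate, map_prod, map_sub, eval_X, Finset.prod_ne_zero_iff,
    Finset.mem_univ, Finset.mem_compl, Finset.mem_singleton, true_imp_iff, sub_ne_zero]
  exact forall₃_congr fun j s u => imp_congr_left ne_comm

theorem fiber_levelDiscr (q : Fin k → ℂ) :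
    fiber (Set.range (genericEqn k r)) (MvPolynomial.map C (levelDiscr k r)) q =
      {z ∈ solutions k r q | NonDegenerate z} := by
  simp only [fiber, solutions, Set.forall_mem_range, map_genericEqn, map_eval_map_C,
    eval_levelDiscr_ne_zero_iff]
  rfl

theorem fiber_insert_levelDiscr (q : Fin k → ℂ) :
    fiber (insert (MvPolynomial.map C (levelDiscr k r)) (Set.range (genericEqn k r))) 1 q =
      {z ∈ solutions k r q | ¬ NonDegenerate z} := by
  simp only [fiber, solutions, Set.forall_mem_insert, Set.forall_mem_range, map_genericEqn,
    map_eval_map_C, map_one, ne_eq, one_ne_zero, not_false_eq_true, and_true,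
    ← eval_levelDiscr_ne_zero_iff, not_not]
  ext z
  exact and_comm

theorem eventually_le_encard_sep_nonDegenerate (h0 : r 0 = 0) (hr : ∀ j < k, r j ≤ r (j + 2)) :
    ∀ᶠ q in generic ℂ (Fin k),
      (distinctChoices k r).encard ≤ {z ∈ solutions k r q | NonDegenerate z}.encard ∧
      (distinctChoices k r)ᶜ.encard ≤ {z ∈ solutions k r q | ¬ NonDegenerate z}.encard := by
  have hfreq := frequently_exists_injective_solutions h0 hr
  simp only [← fiber_levelDiscr, ← fiber_insert_levelDiscr]
  rw [← (Set.toFinite (distinctChoices k r)).cast_ncard_eq,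
    ← (Set.toFinite (distinctChoices k r)ᶜ).cast_ncard_eq]
  refine .and (eventually_le_encard_fiber_of_frequently (hfreq.mono ?_))
    (eventually_le_encard_fiber_of_frequently (hfreq.mono ?_)) <;> rintro q ⟨Z, hZ, hsol⟩
  · rw [fiber_levelDiscr, (Set.toFinite _).cast_ncard_eq]
    exact Set.encard_le_encard_of_injOn (fun α hα => ⟨(hsol α).1, (hsol α).2.2 hα⟩) hZ.injOn
  · rw [fiber_insert_levelDiscr, (Set.toFinite _).cast_ncard_eq]
    exact Set.encard_le_encard_of_injOn (fun α hα => ⟨(hsol α).1, mt (hsol α).2.1 hα⟩) hZ.injOn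

theorem eventually_encard_eq (h0 : r 0 = 0) (hr : ∀ j < k, r j ≤ r (j + 2)) :
    ∀ᶠ q in generic ℂ (Fin k),
      (solutions k r q).encard = (Set.univ : Set (RootChoice k r)).encard ∧
      {z ∈ solutions k r q | NonDegenerate z}.encard = (distinctChoices k r).encard := by
  filter_upwards [eventually_le_encard_sep_nonDegenerate h0 hr,
    eventually_encard_solutions_le hr] with q ⟨hnd, hd⟩ hle
  have hchoices : (Set.univ : Set (RootChoice k r)).encard = (∏ i : Idx k r, r (i.1 + 2) : ℕ) := by
    simp [Set.encard_univ]
  have hsplit : {z ∈ solutions k r q | NonDegenerate z}.encard +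
      {z ∈ solutions k r q | ¬ NonDegenerate z}.encard = (solutions k r q).encard := by
    rw [add_comm]
    exact Set.encard_sdiff_add_encard_inter (solutions k r q) {z | NonDegenerate z}
  rw [← hchoices, ← Set.encard_add_encard_compl (distinctChoices k r), ← hsplit] at hle
  rw [← Set.encard_add_encard_compl (distinctChoices k r), ← hsplit]
  refine ⟨hle.antisymm (add_le_add hnd hd), hnd.antisymm' ?_⟩
  exact (ENat.add_le_add_iff_right (Set.toFinite _).encard_lt_top.ne).1
    ((add_le_add_right hd _).trans hle)

theorem prod_fin_eq_prod_Icc {M : Type*} [CommMonoid M] (f : ℕ → M) (k : ℕ) :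
    ∏ j : Fin k, f (j + 1) = ∏ j ∈ Finset.Icc 1 k, f j := by
  rw [Fin.prod_univ_eq_prod_range (fun j => f (j + 1)) k, Finset.range_eq_Ico,
    Finset.prod_Ico_add' f 0 k 1]
  rfl

theorem encard_distinctChoices (k : ℕ) (r : ℕ → ℕ) : (distinctChoices k r).encard =
    (∏ j ∈ Finset.Icc 1 k, (r (j + 1)).descFactorial (r j) : ℕ) := by
  let e : distinctChoices k r ≃ ((j : Fin k) → Fin (r (j + 1)) ↪ Fin (r (j + 2))) :=
    { toFun := fun α j => ⟨fun s => α.1 ⟨j, s⟩, fun s u h => by_contra fun hne => α.2 j s u hne h⟩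
      invFun := fun g => ⟨fun i => g i.1 i.2, fun j s u hne h => hne ((g j).injective h)⟩ }
  rw [Set.encard, ENat.card_congr e, ENat.card_eq_coe_fintype_card, Fintype.card_pi,
    ← prod_fin_eq_prod_Icc]
  simp only [Fintype.card_embedding_eq, Fintype.card_fin]

theorem encard_rootChoice (k : ℕ) (r : ℕ → ℕ) : (Set.univ : Set (RootChoice k r)).encard =
    (∏ j ∈ Finset.Icc 1 k, r (j + 1) ^ r j : ℕ) := by
  simp [Set.encard_univ, Fintype.prod_sigma, ← prod_fin_eq_prod_Icc]

end Counting

end FlagBethe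

theorem proposition4p7_general (k : ℕ) (r : ℕ → ℕ) (h0 : r 0 = 0)
    (hr : ∀ j < k, r j ≤ r (j + 2)) :
    FlagBethe.ForGeneric k fun q =>
      FlagBethe.N k r q = (∏ j ∈ Finset.Icc 1 k, r (j + 1) ^ r j : ℕ) ∧
      (FlagBethe.solutions k r q).encard = (∏ j ∈ Finset.Icc 1 k, r (j + 1) ^ r j : ℕ) ∧
      {z ∈ FlagBethe.solutions k r q | FlagBethe.NonDegenerate z}.encard =
        (∏ j ∈ Finset.Icc 1 k, (r (j + 1)).descFactorial (r j) : ℕ) := by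
  obtain ⟨F, hF, h⟩ := FlagBethe.eventually_generic_iff.1 (FlagBethe.eventually_encard_eq h0 hr)
  refine ⟨F, hF, fun q _ hq => ?_⟩
  obtain ⟨hall, hnd⟩ := h q hq
  rw [FlagBethe.encard_rootChoice] at hall
  exact ⟨(FlagBethe.N_eq_encard_solutions k r q).trans hall, hall,
    hnd.trans (FlagBethe.encard_distinctChoices k r)⟩

theorem proposition4p7 (k : ℕ) (r : ℕ → ℕ) (h0 : r 0 = 0) (h1 : 0 < r 1)
    (hr : ∀ j, 1 ≤ j → j ≤ k → r j ≤ r (j + 1)) :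
    FlagBethe.ForGeneric k fun q =>
      FlagBethe.N k r q = ((∏ j ∈ Finset.Icc 1 k, r (j + 1) ^ r j : ℕ) : ℕ∞) ∧
      (FlagBethe.solutions k r q).encard = ((∏ j ∈ Finset.Icc 1 k, r (j + 1) ^ r j : ℕ) : ℕ∞) ∧
      {z ∈ FlagBethe.solutions k r q | FlagBethe.NonDegenerate z}.encard =
        ((∏ j ∈ Finset.Icc 1 k, (r (j + 1))! / (r (j + 1) - r j)! : ℕ) : ℕ∞) := by
  rw [← Finset.prod_congr rfl fun j hj => Nat.descFactorial_eq_div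
    (hr j (Finset.mem_Icc.1 hj).1 (Finset.mem_Icc.1 hj).2)]
  exact proposition4p7_general k r h0 fun
    | 0, _ => by simp [h0]
    | j + 1, hj => (hr _ (by omega) hj.le).trans (hr _ (by omega) hj)
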